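/- Let $d\in\mathbb N$ and let $\lambda_1,\dots,\lambda_d>0$ be real numbers. Let $G_A=\mathbb R\ltimes_A\mathbb R^d$, $A=\mathrm{diag}(\lambda_1,\dots,\lambda_d)$, be the corresponding real diagonal Heintze group, i.e. the manifold $\mathbb R\times\mathbb R^d$ with coordinates $(y,x)=(y,x_1,\dots,x_d)$ and the Riemannian metric $$g=dy^2+\sum_{i=1}^d e^{-2\lambda_i y}\,dx_i^2 .$$ Then the set $$V=\Bigl\{(y,x)\in G_A:\ \max_{1\le i\le d}e^{-\lambda_i y/2}|x_i|\le 1\Bigr\}$$ is geodesically convex in $(G_A,g)$: any two points of $V$ can be joined by a geodesic segment of $g$ (a $C^2$ curve $\gamma:[0,1]\to G_A$ with $\nabla_{\gamma'}\gamma'=0$ for the Levi-Civita connection $\nabla$ of $g$), and every geodesic segment of $g$ joining two points of $V$ is contained in $V$. (For $d=0$ the maximum over the empty family is read as $0$.) -/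

import Mathlib

open scoped ContDiff

noncomputable section

/-- A smooth Riemannian metric on the coordinate space `ℝ^ι` (a manifold with one global chart):
`tensor p i j` is the coefficient `g_{ij}(p)`. -/
structure CoordMetric (ι : Type) [Fintype ι] where
  tensor : (ι → ℝ) → Matrix ι ι ℝ
  posDef : ∀ p, (tensor p).PosDef
  smooth : ∀ i j, ContDiff ℝ ∞ (fun p => tensor p i j)

namespace CoordMetric

variable {ι : Type} [Fintype ι] [DecidableEq ι]

/-- The partial derivative `∂_k g_{ij}` at `p`. -/
def partialTensor (g : CoordMetric ι) (p : ι → ℝ) (k i j : ι) : ℝ :=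
  fderiv ℝ (fun q => g.tensor q i j) p (Pi.single k 1)

/-- The Christoffel symbols of the Levi-Civita connection,
`Γ^k_{ij} = (1/2) ∑_l g^{kl} (∂_i g_{jl} + ∂_j g_{il} - ∂_l g_{ij})`. -/
def christoffel (g : CoordMetric ι) (p : ι → ℝ) (k i j : ι) : ℝ :=
  (1 / 2 : ℝ) * ∑ l, (g.tensor p)⁻¹ k l *
    (g.partialTensor p i j l + g.partialTensor p j i l - g.partialTensor p l i j)

/-- The coordinates of the covariant acceleration `∇_{γ'} γ'` of a curve `γ` at time `t`. -/
def acceleration (g : CoordMetric ι) (γ : ℝ → ι → ℝ) (t : ℝ) (k : ι) : ℝ :=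
  deriv (deriv (fun s => γ s k)) t +
    ∑ i, ∑ j, g.christoffel (γ t) k i j * deriv (fun s => γ s i) t * deriv (fun s => γ s j) t

/-- `γ`, restricted to `[0, 1]`, is an (affinely parametrized, possibly constant) geodesic segment
from `p` to `q`: it is `C²` up to the end points and `∇_{γ'} γ' = 0`. -/
structure IsGeodesicSegment (g : CoordMetric ι) (γ : ℝ → ι → ℝ) (p q : ι → ℝ) : Prop where
  contDiffOn : ContDiffOn ℝ 2 γ (Set.Icc 0 1)
  source : γ 0 = p
  target : γ 1 = q
  geodesic : ∀ t ∈ Set.Ioo (0 : ℝ) 1, ∀ k, g.acceleration γ t k = 0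

/-- A set `S` is geodesically convex if any two points of `S` can be joined by a geodesic segment
and every geodesic segment joining two points of `S` is contained in `S`. -/
def IsGeodesicallyConvex (g : CoordMetric ι) (S : Set (ι → ℝ)) : Prop :=
  ∀ p ∈ S, ∀ q ∈ S, (∃ γ, g.IsGeodesicSegment γ p q) ∧
    ∀ γ, g.IsGeodesicSegment γ p q → ∀ t ∈ Set.Icc (0 : ℝ) 1, γ t ∈ S

end CoordMetric

/-- The metric `dy² + ∑_i e^{-2 λ_i y} dx_i²` of the real diagonal Heintze group
`G_A = ℝ ⋉_A ℝ^d`, `A = diag(λ_1, …, λ_d)`. A point `p` has the coordinates `p 0 = y` and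
`p i.succ = x_i`. -/
def heintzeMetric {d : ℕ} (lam : Fin d → ℝ) : CoordMetric (Fin (d + 1)) where
  tensor p := Matrix.diagonal (Fin.cons 1 (fun i => Real.exp (-2 * lam i * p 0)))
  posDef p := by
    refine Matrix.PosDef.diagonal fun k => ?_
    refine Fin.cases ?_ (fun i => ?_) k
    · simp
    · simpa using Real.exp_pos _
  smooth i j := by
    by_cases h : i = j
    · subst h
      refine Fin.cases ?_ (fun i => ?_) i
      · simpa using contDiff_const
      · simp only [Matrix.diagonal_apply_eq, Fin.cons_succ]
        fun_prop
    · simpa [Matrix.diagonal_apply_ne _ h] using contDiff_const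

/-- The set `V` of the points `(y, x)` with `max_i e^{-λ_i y / 2} |x_i| ≤ 1`. -/
def heintzeV {d : ℕ} (lam : Fin d → ℝ) : Set (Fin (d + 1) → ℝ) :=
  {p | (⨆ i : Fin d, Real.exp (-lam i * p 0 / 2) * |p i.succ|) ≤ 1}

end

/-! The geodesic equations are `y'' = -∑ λ_i e^{-2λ_i y} x_i'^2` and `x_i'' = 2 λ_i y' x_i'`; in
particular `y` is concave.

Containment. `V` is cut out by the inequalities `w ≤ 1` with `w = e^{-λ_i y} x_i^2`. Along a
geodesic, `e^{-λ_i y} w'` has derivative `e^{-2λ_i y} (2u^2 - 2uv + 2v^2 - λ_i y'' x_i^2)` with `u =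
x_i'` and `v = λ_i y' x_i`, which is nonnegative. So `w'` is monotone up to a positive weight and
`w` is bounded by its end values (`le_max_of_monotone_mul_deriv`, `heintze_geodesic_mem`).

Existence, for arbitrary end points. The second equation integrates to `x_i' = c_i e^{2λ_i y}` with
`c_i = Δ_i / ∫ e^{2λ_i y}`, so only the height is unknown, and `k = -y''` has to satisfy `k = S k`
with `S = geodesicSource`. The reduced energy `heightEnergy` is minimised over a convex set of
densities that is compact by Arzelà–Ascoli (`exists_isAdmissibleDensity_forall_le`) and mapped into
itself by `S` (`exists_isAdmissibleDensity_geodesicSource`). At a minimiser `k` the direction `φ = S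
k - k` is admissible, and the first variation along it is `-2 ∫ (greenDeriv φ)^2`. It cannot be
negative, so `φ = 0` on `(0, 1)` (`exists_eq_geodesicSource`). -/

section HeintzeGeodesic

/-! ### Membership in `V`, Christoffel symbols and the geodesic equations. -/

theorem mem_heintzeV_iff {d : ℕ} (lam : Fin d → ℝ) (p : Fin (d + 1) → ℝ) :
    p ∈ heintzeV lam ↔ ∀ i : Fin d, Real.exp (-lam i * p 0) * p i.succ ^ 2 ≤ 1 := by
  have key : ∀ i : Fin d, Real.exp (-lam i * p 0) * p i.succ ^ 2 =
      (Real.exp (-lam i * p 0 / 2) * |p i.succ|) ^ 2 := fun i => by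
    rw [mul_pow, sq_abs, ← Real.exp_nat_mul]
    congr 2
    push_cast
    ring
  have hpos : ∀ i : Fin d, 0 ≤ Real.exp (-lam i * p 0 / 2) * |p i.succ| := fun i => by positivity
  simp only [key, sq_le_one_iff₀ (hpos _)]
  constructor
  · intro h i
    exact (le_ciSup (f := fun i : Fin d => Real.exp (-lam i * p 0 / 2) * |p i.succ|)
      (Set.finite_range _).bddAbove i).trans h
  · intro h
    -- `zero_le_one` covers `d = 0`, where the supremum is `0`.
    exact Real.iSup_le h zero_le_one

theorem heintzeMetric_inv {d : ℕ} (lam : Fin d → ℝ) (p : Fin (d + 1) → ℝ) :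
    ((heintzeMetric lam).tensor p)⁻¹ =
      Matrix.diagonal (Fin.cons 1 (fun i => Real.exp (2 * lam i * p 0))) := by
  apply Matrix.inv_eq_left_inv
  rw [heintzeMetric, Matrix.diagonal_mul_diagonal, ← Matrix.diagonal_one]
  congr 1
  funext k
  refine Fin.cases ?_ (fun i => ?_) k
  · simp
  · simp [← Real.exp_add]

theorem heintzeMetric_partialTensor_of_ne {d : ℕ} (lam : Fin d → ℝ) (p : Fin (d + 1) → ℝ)
    (k : Fin (d + 1)) {i j : Fin (d + 1)} (h : i ≠ j) :
    (heintzeMetric lam).partialTensor p k i j = 0 := by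
  simp [CoordMetric.partialTensor, heintzeMetric, Matrix.diagonal_apply_ne _ h]

theorem heintzeMetric_partialTensor_zero {d : ℕ} (lam : Fin d → ℝ) (p : Fin (d + 1) → ℝ)
    (k : Fin (d + 1)) : (heintzeMetric lam).partialTensor p k 0 0 = 0 := by
  simp [CoordMetric.partialTensor, heintzeMetric]

theorem heintzeMetric_partialTensor_succ {d : ℕ} (lam : Fin d → ℝ) (p : Fin (d + 1) → ℝ)
    (k : Fin (d + 1)) (i : Fin d) : (heintzeMetric lam).partialTensor p k i.succ i.succ =
      if k = 0 then -2 * lam i * Real.exp (-2 * lam i * p 0) else 0 := by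
  have h : HasFDerivAt (fun q : Fin (d + 1) → ℝ => Real.exp (-2 * lam i * q 0))
      (Real.exp (-2 * lam i * p 0) • ((-2 * lam i) •
        (ContinuousLinearMap.proj (R := ℝ) (φ := fun _ : Fin (d + 1) => ℝ) 0))) p :=
    (((ContinuousLinearMap.proj (R := ℝ) (φ := fun _ : Fin (d + 1) => ℝ) 0).hasFDerivAt).const_mul
      (-2 * lam i)).exp
  simp only [CoordMetric.partialTensor, heintzeMetric, Matrix.diagonal_apply_eq, Fin.cons_succ]
  rw [h.fderiv]
  by_cases hk : k = 0
  · subst hk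
    simp
    ring
  · simp [hk, Ne.symm hk]

theorem heintzeMetric_christoffel {d : ℕ} (lam : Fin d → ℝ) (p : Fin (d + 1) → ℝ)
    (k i j : Fin (d + 1)) : (heintzeMetric lam).christoffel p k i j =
      (1 / 2 : ℝ) * ((Fin.cons 1 (fun i => Real.exp (2 * lam i * p 0)) : Fin (d + 1) → ℝ) k *
        ((heintzeMetric lam).partialTensor p i j k + (heintzeMetric lam).partialTensor p j i k
          - (heintzeMetric lam).partialTensor p k i j)) := by
  rw [CoordMetric.christoffel, heintzeMetric_inv, Finset.sum_eq_single k]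
  · rw [Matrix.diagonal_apply_eq]
  · intro l _ hl
    rw [Matrix.diagonal_apply_ne _ hl.symm, zero_mul]
  · simp

theorem heintzeMetric_acceleration_zero {d : ℕ} (lam : Fin d → ℝ) (γ : ℝ → Fin (d + 1) → ℝ)
    (t : ℝ) : (heintzeMetric lam).acceleration γ t 0 =
      deriv (deriv fun s => γ s 0) t +
        ∑ i, lam i * Real.exp (-2 * lam i * γ t 0) * deriv (fun s => γ s i.succ) t ^ 2 := by
  rw [CoordMetric.acceleration]
  congr 1
  rw [Fin.sum_univ_succ]
  have h0 : ∀ j, (heintzeMetric lam).christoffel (γ t) 0 0 j = 0 := fun j => by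
    rw [heintzeMetric_christoffel]
    refine Fin.cases ?_ (fun j => ?_) j
    · simp [heintzeMetric_partialTensor_zero]
    · simp [heintzeMetric_partialTensor_zero,
        heintzeMetric_partialTensor_of_ne _ _ _ (Fin.succ_ne_zero j),
        heintzeMetric_partialTensor_of_ne _ _ _ (Fin.succ_ne_zero j).symm]
  simp only [h0, zero_mul, Finset.sum_const_zero, zero_add]
  refine Finset.sum_congr rfl fun i _ => ?_
  rw [Finset.sum_eq_single i.succ]
  · rw [heintzeMetric_christoffel, heintzeMetric_partialTensor_succ,
      heintzeMetric_partialTensor_of_ne _ _ _ (Fin.succ_ne_zero i)]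
    simp
    ring
  · intro j _ hj
    rw [heintzeMetric_christoffel, heintzeMetric_partialTensor_of_ne _ _ _ (Fin.succ_ne_zero i),
      heintzeMetric_partialTensor_of_ne _ _ _ hj.symm]
    by_cases hj0 : j = 0
    · simp [hj0, heintzeMetric_partialTensor_zero]
    · simp [heintzeMetric_partialTensor_of_ne _ _ _ hj0]
  · simp

theorem heintzeMetric_acceleration_succ {d : ℕ} (lam : Fin d → ℝ) (γ : ℝ → Fin (d + 1) → ℝ)
    (t : ℝ) (k : Fin d) : (heintzeMetric lam).acceleration γ t k.succ =
      deriv (deriv fun s => γ s k.succ) t -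
        2 * lam k * deriv (fun s => γ s 0) t * deriv (fun s => γ s k.succ) t := by
  have hexp : Real.exp (2 * lam k * γ t 0) * Real.exp (-2 * lam k * γ t 0) = 1 := by
    rw [← Real.exp_add]
    simp
  have h00 : (heintzeMetric lam).christoffel (γ t) k.succ 0 0 = 0 := by
    rw [heintzeMetric_christoffel, heintzeMetric_partialTensor_zero,
      heintzeMetric_partialTensor_of_ne _ _ _ (Fin.succ_ne_zero k).symm]
    simp
  have h0 : ∀ j : Fin d, (heintzeMetric lam).christoffel (γ t) k.succ 0 j.succ =
      if j = k then -lam k else 0 := fun j => by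
    rw [heintzeMetric_christoffel, heintzeMetric_partialTensor_of_ne _ _ _ (Fin.succ_ne_zero j).symm,
      heintzeMetric_partialTensor_of_ne _ _ _ (Fin.succ_ne_zero k).symm]
    by_cases h : j = k
    · subst h
      rw [heintzeMetric_partialTensor_succ]
      simp only [Fin.cons_succ, if_true]
      linear_combination (-lam j) * hexp
    · rw [heintzeMetric_partialTensor_of_ne _ _ _ (fun e => h (Fin.succ_injective _ e))]
      simp [h]
  have h1 : ∀ i : Fin d, (heintzeMetric lam).christoffel (γ t) k.succ i.succ 0 =
      if i = k then -lam k else 0 := fun i => by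
    rw [← h0, heintzeMetric_christoffel, heintzeMetric_christoffel,
      heintzeMetric_partialTensor_of_ne _ _ _ (Fin.succ_ne_zero i).symm,
      heintzeMetric_partialTensor_of_ne _ _ _ (Fin.succ_ne_zero i)]
    ring
  have h2 : ∀ i j : Fin d, (heintzeMetric lam).christoffel (γ t) k.succ i.succ j.succ = 0 :=
    fun i j => by
    have h : ∀ (l m n : Fin d),
        (heintzeMetric lam).partialTensor (γ t) l.succ m.succ n.succ = 0 := fun l m n => by
      by_cases h : m = n
      · subst h
        simp [heintzeMetric_partialTensor_succ]
      · exact heintzeMetric_partialTensor_of_ne _ _ _ (fun e => h (Fin.succ_injective _ e))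
    simp [heintzeMetric_christoffel, h]
  rw [CoordMetric.acceleration, Fin.sum_univ_succ]
  simp only [Fin.sum_univ_succ (n := d), h00, h0, h1, h2, zero_mul, Finset.sum_const_zero, zero_add,
    add_zero, ite_mul, Finset.sum_ite_eq', Finset.mem_univ, if_true]
  ring

/-! ### Geodesic segments with end points in `V` stay in `V`. -/

theorem le_max_of_monotone_mul_deriv {w w' ρ : ℝ → ℝ} (hw : ContinuousOn w (Set.Icc 0 1))
    (hd : ∀ t ∈ Set.Ioo (0 : ℝ) 1, HasDerivAt w (w' t) t) (hρ : ∀ t, 0 < ρ t)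
    (hm : MonotoneOn (fun t => ρ t * w' t) (Set.Ioo 0 1)) {C : ℝ} (h0 : w 0 ≤ C) (h1 : w 1 ≤ C) :
    ∀ t ∈ Set.Icc (0 : ℝ) 1, w t ≤ C := by
  intro t ht
  by_contra! hC
  have ht0 : 0 < t := ht.1.lt_of_ne fun h => by
    subst h
    linarith
  have ht1 : t < 1 := ht.2.lt_of_ne fun h => by
    subst h
    linarith
  -- An interior value above `C` gives, by the mean value theorem on either side of `t`, points `a <
  -- b` with `w' a > 0 > w' b`; the positive weight keeps these signs, against monotonicity.
  obtain ⟨a, ha, hae⟩ := exists_hasDerivAt_eq_slope w w' ht0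
    (hw.mono (Set.Icc_subset_Icc le_rfl ht.2)) fun s hs => hd s ⟨hs.1, hs.2.trans ht1⟩
  obtain ⟨b, hb, hbe⟩ := exists_hasDerivAt_eq_slope w w' ht1
    (hw.mono (Set.Icc_subset_Icc ht.1 le_rfl)) fun s hs => hd s ⟨ht0.trans hs.1, hs.2⟩
  have hab := hm ⟨ha.1, ha.2.trans ht1⟩ ⟨ht0.trans hb.1, hb.2⟩ (ha.2.trans hb.1).le
  have hapos : 0 < w' a := by
    rw [hae]
    exact div_pos (by linarith) (by linarith)
  have hbneg : w' b < 0 := by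
    rw [hbe]
    exact div_neg_of_neg_of_pos (by linarith) (by linarith)
  have := mul_pos (hρ a) hapos
  have := mul_neg_of_pos_of_neg (hρ b) hbneg
  simp only at hab
  linarith

theorem CoordMetric.IsGeodesicSegment.hasDerivAt {ι : Type} [Fintype ι] [DecidableEq ι]
    {g : CoordMetric ι} {γ : ℝ → ι → ℝ} {p q : ι → ℝ} (h : g.IsGeodesicSegment γ p q) {t : ℝ}
    (ht : t ∈ Set.Ioo (0 : ℝ) 1) (k : ι) :
    HasDerivAt (fun s => γ s k) (deriv (fun s => γ s k) t) t ∧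
      HasDerivAt (deriv fun s => γ s k) (deriv (deriv fun s => γ s k) t) t := by
  have hc : ContDiffAt ℝ 2 (fun s => γ s k) t :=
    contDiffAt_pi.1 (h.contDiffOn.contDiffAt (Icc_mem_nhds ht.1 ht.2)) k
  have hc' : ContDiffAt ℝ 1 (deriv fun s => γ s k) t :=
    ContDiffAt.derivWithin hc (by norm_num)
  exact ⟨(hc.differentiableAt (by norm_num)).hasDerivAt,
    (hc'.differentiableAt (by norm_num)).hasDerivAt⟩

theorem heintze_geodesic_mem {d : ℕ} {lam : Fin d → ℝ} (hlam : ∀ i, 0 < lam i)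
    {p q : Fin (d + 1) → ℝ} (hp : p ∈ heintzeV lam) (hq : q ∈ heintzeV lam)
    {γ : ℝ → Fin (d + 1) → ℝ} (hγ : (heintzeMetric lam).IsGeodesicSegment γ p q) {t : ℝ}
    (ht : t ∈ Set.Icc (0 : ℝ) 1) : γ t ∈ heintzeV lam := by
  rw [mem_heintzeV_iff] at *
  intro i
  set x : ℝ → ℝ := fun s => γ s i.succ with hx
  set y : ℝ → ℝ := fun s => γ s 0 with hy
  have hyd := fun s hs => hγ.hasDerivAt (t := s) hs 0
  have hxd := fun s hs => hγ.hasDerivAt (t := s) hs i.succ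
  have hyacc : ∀ s ∈ Set.Ioo (0 : ℝ) 1, deriv (deriv y) s ≤ 0 := fun s hs => by
    have h := hγ.geodesic s hs 0
    rw [heintzeMetric_acceleration_zero] at h
    have : 0 ≤ ∑ i, lam i * Real.exp (-2 * lam i * γ s 0) * deriv (fun s => γ s i.succ) s ^ 2 :=
      Finset.sum_nonneg fun i _ => by
        have := hlam i
        positivity
    linarith
  have hxacc : ∀ s ∈ Set.Ioo (0 : ℝ) 1, deriv (deriv x) s = 2 * lam i * deriv y s * deriv x s :=
    fun s hs => by
    have h := hγ.geodesic s hs i.succ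
    rw [heintzeMetric_acceleration_succ] at h
    linarith
  have hcont : ContinuousOn γ (Set.Icc 0 1) := hγ.contDiffOn.continuousOn
  have hcy : ContinuousOn y (Set.Icc 0 1) := (continuous_apply _).comp_continuousOn hcont
  have hcx : ContinuousOn x (Set.Icc 0 1) := (continuous_apply _).comp_continuousOn hcont
  have hW : ∀ s ∈ Set.Ioo (0 : ℝ) 1, HasDerivAt
      (fun s => Real.exp (-2 * lam i * y s) * (2 * x s * deriv x s - lam i * deriv y s * x s ^ 2))
      (Real.exp (-2 * lam i * y s) * (2 * deriv x s ^ 2 - 2 * lam i * deriv y s * x s * deriv x s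
        + 2 * (lam i * deriv y s * x s) ^ 2 - lam i * deriv (deriv y) s * x s ^ 2)) s :=
    fun s hs => by
    have h := (((hyd s hs).1.const_mul (-2 * lam i)).exp).mul
      ((((hxd s hs).1.const_mul 2).mul (hxd s hs).2).sub
        (((hyd s hs).2.const_mul (lam i)).mul ((hxd s hs).1.pow 2)))
    refine h.congr_deriv ?_
    -- The equation turns `2 x x''` into `4 λ y' x x'`, which cancels the cross term produced by
    -- differentiating the exponential.
    have := hxacc s hs
    simp only [hx, hy] at this ⊢
    simp only [this, Pi.mul_apply, Pi.sub_apply, Pi.pow_apply]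
    push_cast
    ring
  refine le_max_of_monotone_mul_deriv
    (w := fun s => Real.exp (-lam i * y s) * x s ^ 2)
    (w' := fun s => Real.exp (-lam i * y s) * (2 * x s * deriv x s - lam i * deriv y s * x s ^ 2))
    (ρ := fun s => Real.exp (-lam i * y s)) ?_ ?_ (fun s => Real.exp_pos _) ?_ ?_ ?_ t ht
  · exact (Real.continuous_exp.comp_continuousOn (continuousOn_const.mul hcy)).mul (hcx.pow 2)
  · intro s hs
    refine ((((hyd s hs).1.const_mul (-lam i)).exp).mul ((hxd s hs).1.pow 2)).congr_deriv ?_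
    simp only [hx, hy, Pi.pow_apply]
    push_cast
    ring
  · have he : (fun s => Real.exp (-lam i * y s) * (Real.exp (-lam i * y s) *
        (2 * x s * deriv x s - lam i * deriv y s * x s ^ 2))) = fun s =>
        Real.exp (-2 * lam i * y s) * (2 * x s * deriv x s - lam i * deriv y s * x s ^ 2) := by
      funext s
      rw [← mul_assoc, ← Real.exp_add]
      congr 2
      ring
    rw [he]
    refine monotoneOn_of_deriv_nonneg (convex_Ioo 0 1)
      (fun s hs => (hW s hs).continuousAt.continuousWithinAt) ?_ ?_
    · rw [interior_Ioo]
      exact fun s hs => (hW s hs).differentiableAt.differentiableWithinAt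
    · rw [interior_Ioo]
      intro s hs
      rw [(hW s hs).deriv]
      refine mul_nonneg (Real.exp_pos _).le ?_
      have := mul_nonneg (mul_nonneg (hlam i).le (sub_nonneg.2 (hyacc s hs))) (sq_nonneg (x s))
      -- `2u^2 - 2uv + 2v^2 = (u - v)^2 + u^2 + v^2`.
      nlinarith [sq_nonneg (deriv x s - lam i * deriv y s * x s), sq_nonneg (deriv x s),
        sq_nonneg (lam i * deriv y s * x s)]
  · simpa [hx, hy, hγ.source] using hp i
  · simpa [hx, hy, hγ.target] using hq i

end HeintzeGeodesic

/-! ### The Dirichlet problem `-u'' = k` on `[0, 1]`. -/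

section GreenOperator

open MeasureTheory Filter Topology

/-- The double primitive `t ↦ ∫₀ᵗ ∫₀ˢ k`. -/
noncomputable def doublePrimitive (k : ℝ → ℝ) (t : ℝ) : ℝ := ∫ s in (0 : ℝ)..t, ∫ r in (0 : ℝ)..s, k r

/-- The solution `u` of `-u'' = k` with `u 0 = u 1 = 0`. -/
noncomputable def green (k : ℝ → ℝ) (t : ℝ) : ℝ := t * doublePrimitive k 1 - doublePrimitive k t

/-- The derivative of `green k`. -/
noncomputable def greenDeriv (k : ℝ → ℝ) (t : ℝ) : ℝ := doublePrimitive k 1 - ∫ s in (0 : ℝ)..t, k s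

@[simp] theorem green_zero (k : ℝ → ℝ) : green k 0 = 0 := by simp [green, doublePrimitive]

@[simp] theorem green_one (k : ℝ → ℝ) : green k 1 = 0 := by simp [green]

theorem hasDerivAt_integral_zero {k : ℝ → ℝ} (hk : Continuous k) (t : ℝ) :
    HasDerivAt (fun t => ∫ s in (0 : ℝ)..t, k s) (k t) t :=
  intervalIntegral.integral_hasDerivAt_right (hk.intervalIntegrable _ _)
    (hk.stronglyMeasurableAtFilter _ _) hk.continuousAt

theorem continuous_integral_zero {k : ℝ → ℝ} (hk : Continuous k) :
    Continuous fun t => ∫ s in (0 : ℝ)..t, k s :=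
  continuous_iff_continuousAt.2 fun t => (hasDerivAt_integral_zero hk t).continuousAt

theorem hasDerivAt_green {k : ℝ → ℝ} (hk : Continuous k) (t : ℝ) :
    HasDerivAt (green k) (greenDeriv k t) t := by
  have h := ((hasDerivAt_id t).mul_const (doublePrimitive k 1)).sub
    (hasDerivAt_integral_zero (continuous_integral_zero hk) t)
  rw [one_mul] at h
  exact h

theorem hasDerivAt_greenDeriv {k : ℝ → ℝ} (hk : Continuous k) (t : ℝ) :
    HasDerivAt (greenDeriv k) (-k t) t :=
  (hasDerivAt_integral_zero hk t).const_sub _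

theorem continuous_green {k : ℝ → ℝ} (hk : Continuous k) : Continuous (green k) :=
  continuous_iff_continuousAt.2 fun t => (hasDerivAt_green hk t).continuousAt

theorem continuous_greenDeriv {k : ℝ → ℝ} (hk : Continuous k) : Continuous (greenDeriv k) :=
  continuous_iff_continuousAt.2 fun t => (hasDerivAt_greenDeriv hk t).continuousAt

theorem integral_add_mul {k φ : ℝ → ℝ} (hk : Continuous k) (hφ : Continuous φ) (c t : ℝ) :
    ∫ s in (0 : ℝ)..t, (k s + c * φ s) = (∫ s in (0 : ℝ)..t, k s) + c * ∫ s in (0 : ℝ)..t, φ s := by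
  rw [← intervalIntegral.integral_const_mul]
  exact intervalIntegral.integral_add (hk.intervalIntegrable _ _)
    ((continuous_const.mul hφ).intervalIntegrable _ _)

theorem doublePrimitive_add_mul {k φ : ℝ → ℝ} (hk : Continuous k) (hφ : Continuous φ) (c t : ℝ) :
    doublePrimitive (fun s => k s + c * φ s) t =
      doublePrimitive k t + c * doublePrimitive φ t := by
  simp only [doublePrimitive, integral_add_mul hk hφ]
  exact integral_add_mul (continuous_integral_zero hk) (continuous_integral_zero hφ) c t

theorem green_add_mul {k φ : ℝ → ℝ} (hk : Continuous k) (hφ : Continuous φ) (c t : ℝ) :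
    green (fun s => k s + c * φ s) t = green k t + c * green φ t := by
  simp only [green, doublePrimitive_add_mul hk hφ]
  ring

theorem greenDeriv_add_mul {k φ : ℝ → ℝ} (hk : Continuous k) (hφ : Continuous φ) (c t : ℝ) :
    greenDeriv (fun s => k s + c * φ s) t = greenDeriv k t + c * greenDeriv φ t := by
  simp only [greenDeriv, doublePrimitive_add_mul hk hφ, integral_add_mul hk hφ]
  ring

theorem uIcc_zero_subset {t : ℝ} (ht : t ∈ Set.Icc (0 : ℝ) 1) :
    Set.uIcc 0 t ⊆ Set.Icc (0 : ℝ) 1 := by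
  rw [Set.uIcc_of_le ht.1]
  exact Set.Icc_subset_Icc le_rfl ht.2

theorem integral_congr_Icc {k k' : ℝ → ℝ} (h : Set.EqOn k k' (Set.Icc 0 1)) {t : ℝ}
    (ht : t ∈ Set.Icc (0 : ℝ) 1) : ∫ s in (0 : ℝ)..t, k s = ∫ s in (0 : ℝ)..t, k' s :=
  intervalIntegral.integral_congr fun _ hs => h (uIcc_zero_subset ht hs)

theorem doublePrimitive_congr {k k' : ℝ → ℝ} (h : Set.EqOn k k' (Set.Icc 0 1)) :
    Set.EqOn (doublePrimitive k) (doublePrimitive k') (Set.Icc 0 1) := fun _ ht =>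
  integral_congr_Icc (fun _ hs => integral_congr_Icc h hs) ht

theorem green_congr {k k' : ℝ → ℝ} (h : Set.EqOn k k' (Set.Icc 0 1)) :
    Set.EqOn (green k) (green k') (Set.Icc 0 1) := fun t ht => by
  rw [green, green, doublePrimitive_congr h ht, doublePrimitive_congr h (by simp)]

theorem greenDeriv_congr {k k' : ℝ → ℝ} (h : Set.EqOn k k' (Set.Icc 0 1)) :
    Set.EqOn (greenDeriv k) (greenDeriv k') (Set.Icc 0 1) := fun t ht => by
  rw [greenDeriv, greenDeriv, doublePrimitive_congr h (by simp), integral_congr_Icc h ht]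

theorem integral_zero_mono {k : ℝ → ℝ} (hk : Continuous k)
    (h0 : ∀ t ∈ Set.Icc (0 : ℝ) 1, 0 ≤ k t) :
    MonotoneOn (fun t => ∫ s in (0 : ℝ)..t, k s) (Set.Icc 0 1) := by
  refine monotoneOn_of_deriv_nonneg (convex_Icc 0 1) (continuous_integral_zero hk).continuousOn
    (fun t _ => (hasDerivAt_integral_zero hk t).differentiableAt.differentiableWithinAt) ?_
  intro t ht
  rw [(hasDerivAt_integral_zero hk t).deriv]
  exact h0 t (interior_subset ht)

theorem integral_zero_mem {k : ℝ → ℝ} (hk : Continuous k)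
    (h0 : ∀ t ∈ Set.Icc (0 : ℝ) 1, 0 ≤ k t) {t : ℝ} (ht : t ∈ Set.Icc (0 : ℝ) 1) :
    (∫ s in (0 : ℝ)..t, k s) ∈ Set.Icc 0 (∫ s in (0 : ℝ)..1, k s) := by
  have hm := integral_zero_mono hk h0
  refine ⟨?_, hm ht (by simp) ht.2⟩
  simpa using hm (a := 0) (by simp) ht ht.1

theorem doublePrimitive_nonneg {k : ℝ → ℝ} (hk : Continuous k)
    (h0 : ∀ t ∈ Set.Icc (0 : ℝ) 1, 0 ≤ k t) {t : ℝ} (ht : t ∈ Set.Icc (0 : ℝ) 1) :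
    0 ≤ doublePrimitive k t :=
  (integral_zero_mem (continuous_integral_zero hk) (fun _ hs => (integral_zero_mem hk h0 hs).1) ht).1

theorem doublePrimitive_one_le {k : ℝ → ℝ} (hk : Continuous k)
    (h0 : ∀ t ∈ Set.Icc (0 : ℝ) 1, 0 ≤ k t) :
    doublePrimitive k 1 ≤ ∫ s in (0 : ℝ)..1, k s := by
  have h := intervalIntegral.integral_mono_on (μ := volume) (zero_le_one (α := ℝ))
    ((continuous_integral_zero hk).intervalIntegrable _ _)
    (continuous_const.intervalIntegrable _ _) fun s hs => (integral_zero_mem hk h0 hs).2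
  simpa [doublePrimitive] using h

/-- A concave function lies above its chord, which is zero here. -/
theorem green_nonneg {k : ℝ → ℝ} (hk : Continuous k)
    (h0 : ∀ t ∈ Set.Icc (0 : ℝ) 1, 0 ≤ k t) {t : ℝ} (ht : t ∈ Set.Icc (0 : ℝ) 1) :
    0 ≤ green k t := by
  have hd : deriv (green k) = greenDeriv k := funext fun s => (hasDerivAt_green hk s).deriv
  have hc : ConcaveOn ℝ (Set.Icc 0 1) (green k) := by
    refine AntitoneOn.concaveOn_of_deriv (convex_Icc 0 1) (continuous_green hk).continuousOn
      (fun s _ => (hasDerivAt_green hk s).differentiableAt.differentiableWithinAt) ?_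
    rw [hd]
    intro a ha b hb hab
    exact sub_le_sub_left
      (integral_zero_mono hk h0 (interior_subset ha) (interior_subset hb) hab) _
  have := hc.2 (x := 0) (by simp) (y := 1) (by simp) (sub_nonneg.2 ht.2) ht.1 (by ring)
  simpa using this

theorem green_le {k : ℝ → ℝ} (hk : Continuous k)
    (h0 : ∀ t ∈ Set.Icc (0 : ℝ) 1, 0 ≤ k t) {t : ℝ} (ht : t ∈ Set.Icc (0 : ℝ) 1) :
    green k t ≤ ∫ s in (0 : ℝ)..1, k s := by
  have h1 := doublePrimitive_nonneg hk h0 ht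
  have h2 := doublePrimitive_nonneg hk h0 (t := 1) (by simp)
  have h3 := mul_le_mul_of_nonneg_right ht.2 h2
  have h4 := doublePrimitive_one_le hk h0
  rw [green]
  linarith

theorem abs_greenDeriv_le {k : ℝ → ℝ} (hk : Continuous k)
    (h0 : ∀ t ∈ Set.Icc (0 : ℝ) 1, 0 ≤ k t) {t : ℝ} (ht : t ∈ Set.Icc (0 : ℝ) 1) :
    |greenDeriv k t| ≤ ∫ s in (0 : ℝ)..1, k s := by
  have h2 := doublePrimitive_nonneg hk h0 (t := 1) (by simp)
  have h4 := doublePrimitive_one_le hk h0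
  have h5 := integral_zero_mem hk h0 ht
  rw [greenDeriv, abs_le]
  constructor <;> linarith [h5.1, h5.2]

/-- Integration by parts, without boundary terms since `green φ` vanishes at both ends. It rewrites
the first variation as a Dirichlet inner product. -/
theorem integral_mul_green {k φ : ℝ → ℝ} (hk : Continuous k) (hφ : Continuous φ) :
    ∫ t in (0 : ℝ)..1, k t * green φ t = ∫ t in (0 : ℝ)..1, greenDeriv k t * greenDeriv φ t := by
  have h := intervalIntegral.integral_mul_deriv_eq_deriv_mul (a := 0) (b := 1)
    (u := green φ) (v := greenDeriv k) (u' := greenDeriv φ) (v' := fun t => -k t)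
    (fun t _ => hasDerivAt_green hφ t) (fun t _ => hasDerivAt_greenDeriv hk t)
    ((continuous_greenDeriv hφ).intervalIntegrable _ _) (hk.neg.intervalIntegrable _ _)
  simp only [green_zero, green_one, zero_mul, sub_self, zero_sub, mul_neg,
    intervalIntegral.integral_neg, neg_inj] at h
  simp only [mul_comm (k _), mul_comm (greenDeriv k _)]
  exact h

theorem eq_zero_of_integral_greenDeriv_sq_nonpos {φ : ℝ → ℝ} (hφ : Continuous φ)
    (h : ∫ t in (0 : ℝ)..1, greenDeriv φ t ^ 2 ≤ 0) : ∀ t ∈ Set.Ioo (0 : ℝ) 1, φ t = 0 := by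
  have hz : ∀ t ∈ Set.Icc (0 : ℝ) 1, greenDeriv φ t = 0 := by
    by_contra! hne
    obtain ⟨t, ht, hne⟩ := hne
    refine absurd h (not_le.2 ?_)
    exact intervalIntegral.integral_pos zero_lt_one ((continuous_greenDeriv hφ).pow 2).continuousOn
      (fun s _ => sq_nonneg _) ⟨t, ht, by positivity⟩
  intro t ht
  have he : greenDeriv φ =ᶠ[𝓝 t] fun _ => 0 :=
    (Icc_mem_nhds ht.1 ht.2 |> Filter.mem_of_superset) fun s hs => hz s hs
  have := (hasDerivAt_greenDeriv hφ t).unique ((hasDerivAt_const t (0 : ℝ)).congr_of_eventuallyEq he)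
  linarith

/-- One-sided because competitors `k + c φ` are available only for `c ≥ 0`. -/
theorem HasDerivAt.nonneg_of_eventually_le {f : ℝ → ℝ} {f' : ℝ} (hf : HasDerivAt f f' 0)
    (h : ∀ᶠ s in 𝓝[>] (0 : ℝ), f 0 ≤ f s) : 0 ≤ f' := by
  have ht := (hasDerivAt_iff_tendsto_slope.1 hf).mono_left
    (nhdsWithin_mono (0 : ℝ) fun s (hs : s ∈ Set.Ioi (0 : ℝ)) => (Set.mem_Ioi.1 hs).ne')
  refine ge_of_tendsto ht ?_
  filter_upwards [h, self_mem_nhdsWithin] with s hs hs0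
  rw [slope_def_field]
  exact div_nonneg (sub_nonneg.2 hs) (sub_nonneg.2 (le_of_lt hs0))

/-! ### Compactness and convexity of the set of densities. -/

/-- The nonnegative functions on `[0, 1]` with given bounds for the function, for its Lipschitz
constant and for its integral. -/
structure IsAdmissibleDensity (M N B : ℝ) (k : ℝ → ℝ) : Prop where
  nonneg : ∀ t ∈ Set.Icc (0 : ℝ) 1, 0 ≤ k t
  le : ∀ t ∈ Set.Icc (0 : ℝ) 1, k t ≤ M
  lipschitz : ∀ s ∈ Set.Icc (0 : ℝ) 1, ∀ t ∈ Set.Icc (0 : ℝ) 1, |k s - k t| ≤ N * |s - t|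
  integral_le : ∫ t in (0 : ℝ)..1, k t ≤ B

theorem IsAdmissibleDensity.congr {M N B : ℝ} {k k' : ℝ → ℝ} (hk : IsAdmissibleDensity M N B k)
    (h : Set.EqOn k k' (Set.Icc 0 1)) : IsAdmissibleDensity M N B k' where
  nonneg t ht := h ht ▸ hk.nonneg t ht
  le t ht := h ht ▸ hk.le t ht
  lipschitz s hs t ht := h hs ▸ h ht ▸ hk.lipschitz s hs t ht
  integral_le := integral_congr_Icc h (t := 1) (by simp) ▸ hk.integral_le

theorem IsAdmissibleDensity.add_mul_sub {M N B : ℝ} {k l : ℝ → ℝ} (hk : IsAdmissibleDensity M N B k)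
    (hl : IsAdmissibleDensity M N B l) (hkc : Continuous k) (hlc : Continuous l) {c : ℝ}
    (hc : c ∈ Set.Icc (0 : ℝ) 1) :
    IsAdmissibleDensity M N B fun t => k t + c * (l t - k t) := by
  have hc0 := hc.1
  have hc1 : 0 ≤ 1 - c := sub_nonneg.2 hc.2
  refine ⟨fun t ht => ?_, fun t ht => ?_, fun s hs t ht => ?_, ?_⟩
  · nlinarith [mul_nonneg hc0 (hl.nonneg t ht), mul_nonneg hc1 (hk.nonneg t ht)]
  · nlinarith [mul_le_mul_of_nonneg_left (hl.le t ht) hc0,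
      mul_le_mul_of_nonneg_left (hk.le t ht) hc1]
  · have h1 := mul_le_mul_of_nonneg_left (hl.lipschitz s hs t ht) hc0
    have h2 := mul_le_mul_of_nonneg_left (hk.lipschitz s hs t ht) hc1
    calc |k s + c * (l s - k s) - (k t + c * (l t - k t))|
        = |c * (l s - l t) + (1 - c) * (k s - k t)| := by ring_nf
      _ ≤ |c * (l s - l t)| + |(1 - c) * (k s - k t)| := abs_add_le _ _
      _ = c * |l s - l t| + (1 - c) * |k s - k t| := by
        rw [abs_mul, abs_mul, abs_of_nonneg hc0, abs_of_nonneg hc1]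
      _ ≤ N * |s - t| := by linarith
  · have h : ∫ t in (0 : ℝ)..1, (k t + c * (l t - k t)) = _ :=
      integral_add_mul hkc (φ := fun t => l t - k t) (hlc.sub hkc) c 1
    rw [h, intervalIntegral.integral_sub
      (hlc.intervalIntegrable _ _) (hkc.intervalIntegrable _ _)]
    nlinarith [mul_le_mul_of_nonneg_left hl.integral_le hc0,
      mul_le_mul_of_nonneg_left hk.integral_le hc1]

open BoundedContinuousFunction in
theorem continuous_uncurry_IccExtend : Continuous fun z : (Set.Icc (0 : ℝ) 1 →ᵇ ℝ) × ℝ =>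
    Set.IccExtend zero_le_one z.1 z.2 :=
  (ContinuousEval.continuous_eval (F := Set.Icc (0 : ℝ) 1 →ᵇ ℝ)).comp
    (continuous_fst.prodMk ((continuous_projIcc (h := zero_le_one)).comp continuous_snd))

open BoundedContinuousFunction in
-- The uniform bound and the common Lipschitz constant give compactness by Arzelà–Ascoli in the
-- bounded continuous functions on `[0, 1]`. Since `J` sees only the restriction to `[0, 1]`,
-- `Set.IccExtend` passes between these and functions on `ℝ`.
theorem exists_isAdmissibleDensity_forall_le {M N B : ℝ} (hM : 0 ≤ M) (hN : 0 ≤ N) (hB : 0 ≤ B)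
    {J : (ℝ → ℝ) → ℝ} (hJ : ∀ k k', Set.EqOn k k' (Set.Icc 0 1) → J k = J k')
    (hJc : Continuous fun k : Set.Icc (0 : ℝ) 1 →ᵇ ℝ => J (Set.IccExtend zero_le_one k)) :
    ∃ h, Continuous h ∧ IsAdmissibleDensity M N B h ∧
      ∀ k, Continuous k → IsAdmissibleDensity M N B k → J h ≤ J k := by
  set K : Set (Set.Icc (0 : ℝ) 1 →ᵇ ℝ) :=
    {k | IsAdmissibleDensity M N B (Set.IccExtend zero_le_one k)} with hK
  have hev : ∀ t, Continuous fun k : Set.Icc (0 : ℝ) 1 →ᵇ ℝ =>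
      Set.IccExtend zero_le_one k t := fun t =>
    continuous_uncurry_IccExtend.comp (continuous_id.prodMk continuous_const)
  have hclosed : IsClosed K := by
    have : K = {k : Set.Icc (0 : ℝ) 1 →ᵇ ℝ | ∀ t ∈ Set.Icc (0 : ℝ) 1,
          0 ≤ Set.IccExtend zero_le_one k t} ∩
        {k : Set.Icc (0 : ℝ) 1 →ᵇ ℝ | ∀ t ∈ Set.Icc (0 : ℝ) 1,
          Set.IccExtend zero_le_one k t ≤ M} ∩
        {k : Set.Icc (0 : ℝ) 1 →ᵇ ℝ | ∀ s ∈ Set.Icc (0 : ℝ) 1, ∀ t ∈ Set.Icc (0 : ℝ) 1,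
          |Set.IccExtend zero_le_one k s - Set.IccExtend zero_le_one k t| ≤ N * |s - t|} ∩
        {k : Set.Icc (0 : ℝ) 1 →ᵇ ℝ | ∫ t in (0 : ℝ)..1, Set.IccExtend zero_le_one k t ≤ B} := by
      ext k
      exact ⟨fun h => ⟨⟨⟨h.1, h.2⟩, h.3⟩, h.4⟩, fun h => ⟨h.1.1.1, h.1.1.2, h.1.2, h.2⟩⟩
    rw [this]
    simp only [Set.ofPred_forall]
    refine ((IsClosed.inter ?_ ?_).inter ?_).inter ?_
    · exact isClosed_iInter fun t => isClosed_iInter fun _ => isClosed_le continuous_const (hev t)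
    · exact isClosed_iInter fun t => isClosed_iInter fun _ => isClosed_le (hev t) continuous_const
    · exact isClosed_iInter fun s => isClosed_iInter fun _ => isClosed_iInter fun t =>
        isClosed_iInter fun _ => isClosed_le ((hev s).sub (hev t)).abs continuous_const
    · exact isClosed_le (intervalIntegral.continuous_parametric_intervalIntegral_of_continuous'
        continuous_uncurry_IccExtend _ _) continuous_const
  have hcomp : IsCompact K := by
    refine arzela_ascoli₂ (Set.Icc 0 M) isCompact_Icc K hclosed (fun k t hk => ?_) ?_
    · have := hk.nonneg t t.2
      have := hk.le t t.2
      simp only [Set.IccExtend_val] at *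
      exact ⟨by assumption, by assumption⟩
    · refine LipschitzWith.uniformEquicontinuous (fun k : K => (k : Set.Icc (0 : ℝ) 1 →ᵇ ℝ))
        ⟨N, hN⟩ (fun k => ?_) |>.equicontinuous
      refine LipschitzWith.of_dist_le_mul fun s t => ?_
      have := k.2.lipschitz s s.2 t t.2
      simp only [Set.IccExtend_val] at this
      exact this
  have hne : K.Nonempty := ⟨0, by
    have h0 : Set.IccExtend zero_le_one (0 : Set.Icc (0 : ℝ) 1 →ᵇ ℝ) = fun _ => (0 : ℝ) := by
      ext t
      simp [Set.IccExtend]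
    rw [hK, Set.mem_ofPred_eq, h0]
    exact ⟨by simp, by simpa using fun _ _ _ => hM,
      fun s _ t _ => by simpa using mul_nonneg hN (abs_nonneg _), by simpa using hB⟩⟩
  obtain ⟨h, hhK, hmin⟩ := hcomp.exists_isMinOn hne hJc.continuousOn
  refine ⟨Set.IccExtend zero_le_one h, h.continuous.Icc_extend', hhK, fun k hk hka => ?_⟩
  set k' : Set.Icc (0 : ℝ) 1 →ᵇ ℝ := mkOfCompact ⟨fun t => k t, hk.comp continuous_subtype_val⟩
  have he : Set.EqOn k (Set.IccExtend zero_le_one k') (Set.Icc 0 1) := fun t ht => by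
    rw [Set.IccExtend_of_mem _ _ ht]
    rfl
  rw [hJ k _ he]
  exact hmin (hka.congr he)

end GreenOperator

/-! ### The height equation and its reduced energy. -/

section HeintzeExistence

open MeasureTheory Filter Topology

/-- The height `y` with `y 0 = a`, `y 1 = b` and `-y'' = k`. -/
noncomputable def height (a b : ℝ) (k : ℝ → ℝ) (t : ℝ) : ℝ := a + t * (b - a) + green k t

/-- The total mass of `e ^ {2 μ y}`, `y` being the height of `k`. -/
noncomputable def expMass (a b μ : ℝ) (k : ℝ → ℝ) : ℝ :=
  ∫ t in (0 : ℝ)..1, Real.exp (2 * μ * height a b k t)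

variable {d : ℕ}

/-- The right hand side `f` of the equation `-y'' = f` satisfied by the height `y` of a geodesic
with horizontal displacement `Δ`. -/
noncomputable def geodesicSource (lam Δ : Fin d → ℝ) (a b : ℝ) (k : ℝ → ℝ) (t : ℝ) : ℝ :=
  ∑ i, lam i * Δ i ^ 2 / expMass a b (lam i) k ^ 2 * Real.exp (2 * lam i * height a b k t)

/-- Up to an additive constant, twice the least energy of the curves with horizontal displacement
`Δ` and with the height of `k`. -/
noncomputable def heightEnergy (lam Δ : Fin d → ℝ) (a b : ℝ) (k : ℝ → ℝ) : ℝ :=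
  (∫ t in (0 : ℝ)..1, greenDeriv k t ^ 2) + ∑ i, Δ i ^ 2 / expMass a b (lam i) k

theorem hasDerivAt_height (a b : ℝ) {k : ℝ → ℝ} (hk : Continuous k) (t : ℝ) :
    HasDerivAt (height a b k) (b - a + greenDeriv k t) t := by
  have h := (((hasDerivAt_id t).mul_const (b - a)).const_add a).add (hasDerivAt_green hk t)
  rw [one_mul] at h
  exact h

theorem continuous_height (a b : ℝ) {k : ℝ → ℝ} (hk : Continuous k) :
    Continuous (height a b k) :=
  continuous_iff_continuousAt.2 fun t => (hasDerivAt_height a b hk t).continuousAt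

theorem continuous_exp_height (a b μ : ℝ) {k : ℝ → ℝ} (hk : Continuous k) :
    Continuous fun t => Real.exp (2 * μ * height a b k t) :=
  Real.continuous_exp.comp (continuous_const.mul (continuous_height a b hk))

theorem expMass_pos (a b μ : ℝ) {k : ℝ → ℝ} (hk : Continuous k) : 0 < expMass a b μ k :=
  intervalIntegral.intervalIntegral_pos_of_pos ((continuous_exp_height a b μ hk).intervalIntegrable _ _)
    (fun _ => Real.exp_pos _) zero_lt_one

theorem continuous_geodesicSource (lam Δ : Fin d → ℝ) (a b : ℝ) {k : ℝ → ℝ} (hk : Continuous k) :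
    Continuous (geodesicSource lam Δ a b k) :=
  continuous_finsetSum _ fun i _ => continuous_const.mul (continuous_exp_height a b (lam i) hk)

theorem integral_geodesicSource_mul (lam Δ : Fin d → ℝ) (a b : ℝ) {k φ : ℝ → ℝ}
    (hk : Continuous k) (hφ : Continuous φ) :
    ∫ t in (0 : ℝ)..1, geodesicSource lam Δ a b k t * φ t =
      ∑ i, lam i * Δ i ^ 2 / expMass a b (lam i) k ^ 2 *
        ∫ t in (0 : ℝ)..1, Real.exp (2 * lam i * height a b k t) * φ t := by
  simp only [geodesicSource, Finset.sum_mul, mul_assoc]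
  rw [intervalIntegral.integral_finsetSum]
  · simp only [intervalIntegral.integral_const_mul]
  · intro i _
    refine (continuous_const.mul (Continuous.mul ?_ hφ)).intervalIntegrable _ _
    simpa only [mul_assoc] using continuous_exp_height a b (lam i) hk

theorem integral_geodesicSource (lam Δ : Fin d → ℝ) (a b : ℝ) {k : ℝ → ℝ} (hk : Continuous k) :
    ∫ t in (0 : ℝ)..1, geodesicSource lam Δ a b k t =
      ∑ i, lam i * Δ i ^ 2 / expMass a b (lam i) k := by
  have h := integral_geodesicSource_mul lam Δ a b hk (φ := fun _ => 1) continuous_const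
  simp only [mul_one] at h
  rw [h]
  refine Finset.sum_congr rfl fun i _ => ?_
  have := (expMass_pos a b (lam i) hk).ne'
  change _ * expMass a b (lam i) k = _
  field_simp

theorem segment_mem {a b t : ℝ} (ht : t ∈ Set.Icc (0 : ℝ) 1) :
    min a b ≤ a + t * (b - a) ∧ a + t * (b - a) ≤ max a b := by
  have h1 := sub_nonneg.2 ht.2
  constructor
  · nlinarith [mul_le_mul_of_nonneg_left (min_le_left a b) h1,
      mul_le_mul_of_nonneg_left (min_le_right a b) ht.1]
  · nlinarith [mul_le_mul_of_nonneg_left (le_max_left a b) h1,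
      mul_le_mul_of_nonneg_left (le_max_right a b) ht.1]

/-- For `k ≥ 0` the height lies above the chord from `a` to `b`. The bound does not depend on the
size of `k`. -/
theorem le_expMass {a b μ : ℝ} (hμ : 0 < μ) {k : ℝ → ℝ} (hk : Continuous k)
    (h0 : ∀ t ∈ Set.Icc (0 : ℝ) 1, 0 ≤ k t) :
    Real.exp (2 * μ * min a b) ≤ expMass a b μ k := by
  have h := intervalIntegral.integral_mono_on (μ := volume) (zero_le_one (α := ℝ))
    (continuous_const.intervalIntegrable _ _)
    ((continuous_exp_height a b μ hk).intervalIntegrable _ _)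
    (f := fun _ => Real.exp (2 * μ * min a b)) fun t ht => by
      have := (segment_mem (a := a) (b := b) ht).1
      have := green_nonneg hk h0 ht
      refine Real.exp_le_exp.2 (mul_le_mul_of_nonneg_left ?_ (by positivity))
      rw [height]
      linarith
  simpa [expMass] using h

/-- The constants are not circular. The lower bound on the masses uses only `k ≥ 0` and bounds the
integral of the source by `B`. Then `∫ k ≤ B` gives `y ≤ max a b + B` and `|y'| ≤ |b - a| + B`,
hence `M` and `N`. -/
theorem exists_isAdmissibleDensity_geodesicSource {lam : Fin d → ℝ} (hlam : ∀ i, 0 < lam i)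
    (Δ : Fin d → ℝ) (a b : ℝ) : ∃ M N B : ℝ, 0 ≤ M ∧ 0 ≤ N ∧ 0 ≤ B ∧
      ∀ k, Continuous k → IsAdmissibleDensity M N B k →
        IsAdmissibleDensity M N B (geodesicSource lam Δ a b k) := by
  set e : Fin d → ℝ := fun i => Real.exp (2 * lam i * min a b) with he
  have hepos : ∀ i, 0 < e i := fun i => Real.exp_pos _
  set B : ℝ := ∑ i, lam i * Δ i ^ 2 / e i with hB
  have hB0 : 0 ≤ B := Finset.sum_nonneg fun i _ => by
    have := hlam i
    have := hepos i
    positivity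
  set E : Fin d → ℝ := fun i => Real.exp (2 * lam i * (max a b + B)) with hE
  set M : ℝ := ∑ i, lam i * Δ i ^ 2 / e i ^ 2 * E i with hM
  set N : ℝ := ∑ i, lam i * Δ i ^ 2 / e i ^ 2 * (E i * (2 * lam i * (|b - a| + B))) with hN
  have hc : ∀ i, 0 ≤ lam i * Δ i ^ 2 / e i ^ 2 := fun i => by
    have := hlam i
    have := hepos i
    positivity
  refine ⟨M, N, B, Finset.sum_nonneg fun i _ => mul_nonneg (hc i) (Real.exp_pos _).le,
    Finset.sum_nonneg fun i _ => mul_nonneg (hc i) (mul_nonneg (Real.exp_pos _).le ?_), hB0,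
    fun k hk hka => ?_⟩
  · have := hlam i
    positivity
  have hmass : ∀ i, e i ≤ expMass a b (lam i) k := fun i => le_expMass (hlam i) hk hka.nonneg
  have hcoef : ∀ i, lam i * Δ i ^ 2 / expMass a b (lam i) k ^ 2 ≤ lam i * Δ i ^ 2 / e i ^ 2 :=
    fun i => by
    have := hlam i
    have := hepos i
    have := hmass i
    gcongr
  have hcoef0 : ∀ i, 0 ≤ lam i * Δ i ^ 2 / expMass a b (lam i) k ^ 2 := fun i => by
    have := hlam i
    positivity
  have hexp : ∀ i, ∀ t ∈ Set.Icc (0 : ℝ) 1, Real.exp (2 * lam i * height a b k t) ≤ E i :=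
    fun i t ht => by
    have := (segment_mem (a := a) (b := b) ht).2
    have := (green_le hk hka.nonneg ht).trans hka.integral_le
    have := hlam i
    refine Real.exp_le_exp.2 (mul_le_mul_of_nonneg_left ?_ (by positivity))
    rw [height]
    linarith
  refine ⟨fun t _ => ?_, fun t ht => ?_, fun s hs t ht => ?_, ?_⟩
  · exact Finset.sum_nonneg fun i _ => mul_nonneg (hcoef0 i) (Real.exp_pos _).le
  · exact Finset.sum_le_sum fun i _ =>
      mul_le_mul (hcoef i) (hexp i t ht) (Real.exp_pos _).le (hc i)
  · have hd : ∀ r, HasDerivAt (geodesicSource lam Δ a b k)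
        (∑ i, lam i * Δ i ^ 2 / expMass a b (lam i) k ^ 2 *
          (Real.exp (2 * lam i * height a b k r) *
            (2 * lam i * (b - a + greenDeriv k r)))) r := fun r =>
      HasDerivAt.fun_sum fun i _ =>
        (((hasDerivAt_height a b hk r).const_mul (2 * lam i)).exp).const_mul _
    refine (convex_Icc (0 : ℝ) 1).norm_image_sub_le_of_norm_hasDerivWithin_le
      (fun r _ => (hd r).hasDerivWithinAt) (fun r hr => ?_) ht hs
    refine (norm_sum_le _ _).trans (Finset.sum_le_sum fun i _ => ?_)
    have h1 := (abs_greenDeriv_le hk hka.nonneg hr).trans hka.integral_le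
    have h2 := abs_add_le (b - a) (greenDeriv k r)
    have h3 := hlam i
    have h4 := hexp i r hr
    have h5 := hcoef i
    rw [norm_mul, norm_mul, norm_mul, Real.norm_of_nonneg (hcoef0 i),
      Real.norm_of_nonneg (Real.exp_pos _).le, Real.norm_of_nonneg (by positivity : 0 ≤ 2 * lam i),
      Real.norm_eq_abs]
    have h6 : |b - a + greenDeriv k r| ≤ |b - a| + B := by linarith
    have := hc i
    gcongr
  · rw [integral_geodesicSource _ _ _ _ hk]
    refine Finset.sum_le_sum fun i _ => ?_
    have := hlam i
    have := hepos i
    have := hmass i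
    gcongr

theorem expMass_congr (a b μ : ℝ) {k k' : ℝ → ℝ} (h : Set.EqOn k k' (Set.Icc 0 1)) :
    expMass a b μ k = expMass a b μ k' :=
  integral_congr_Icc (t := 1) (fun t ht => by simp only [height, green_congr h ht]) (by simp)

theorem heightEnergy_congr (lam Δ : Fin d → ℝ) (a b : ℝ) {k k' : ℝ → ℝ}
    (h : Set.EqOn k k' (Set.Icc 0 1)) :
    heightEnergy lam Δ a b k = heightEnergy lam Δ a b k' := by
  simp only [heightEnergy, expMass_congr a b _ h]
  congr 1
  exact integral_congr_Icc (t := 1) (fun t ht => by simp only [greenDeriv_congr h ht]) (by simp)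

/-! ### Continuous dependence of the energy on the density. -/

section Continuity

variable {X : Type*} [TopologicalSpace X] {F : X → ℝ → ℝ}

theorem continuous_uncurry_integral (hF : Continuous F.uncurry) :
    Continuous (Function.uncurry fun x t => ∫ s in (0 : ℝ)..t, F x s) :=
  intervalIntegral.continuous_parametric_intervalIntegral_of_continuous
    (f := fun (z : X × ℝ) s => F z.1 s)
    (hF.comp ((continuous_fst.comp continuous_fst).prodMk continuous_snd)) continuous_snd

theorem continuous_uncurry_doublePrimitive (hF : Continuous F.uncurry) :
    Continuous (Function.uncurry fun x t => doublePrimitive (F x) t) :=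
  continuous_uncurry_integral (continuous_uncurry_integral hF)

theorem continuous_doublePrimitive_one (hF : Continuous F.uncurry) :
    Continuous fun z : X × ℝ => doublePrimitive (F z.1) 1 :=
  (continuous_uncurry_doublePrimitive hF).comp (continuous_fst.prodMk continuous_const)

theorem continuous_uncurry_green (hF : Continuous F.uncurry) :
    Continuous (Function.uncurry fun x t => green (F x) t) :=
  (continuous_snd.mul (continuous_doublePrimitive_one hF)).sub
    (continuous_uncurry_doublePrimitive hF)

theorem continuous_uncurry_greenDeriv (hF : Continuous F.uncurry) :
    Continuous (Function.uncurry fun x t => greenDeriv (F x) t) :=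
  (continuous_doublePrimitive_one hF).sub (continuous_uncurry_integral hF)

theorem continuous_heightEnergy (lam Δ : Fin d → ℝ) (a b : ℝ) (hF : Continuous F.uncurry)
    (hFc : ∀ x, Continuous (F x)) : Continuous fun x => heightEnergy lam Δ a b (F x) := by
  refine Continuous.add ?_ (continuous_finsetSum _ fun i _ => continuous_const.div ?_ fun x =>
    (expMass_pos a b (lam i) (hFc x)).ne')
  · exact intervalIntegral.continuous_parametric_intervalIntegral_of_continuous'
      (f := fun x t => greenDeriv (F x) t ^ 2) ((continuous_pow 2).comp (continuous_uncurry_greenDeriv hF))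
      _ _
  · refine intervalIntegral.continuous_parametric_intervalIntegral_of_continuous'
      (f := fun x t => Real.exp (2 * lam i * height a b (F x) t)) ?_ _ _
    exact Real.continuous_exp.comp (continuous_const.mul
      ((continuous_const.add (continuous_snd.mul continuous_const)).add
        (continuous_uncurry_green hF)))

end Continuity

/-! ### First variation and solution of the height equation. -/

theorem expMass_add_mul_le (a b μ : ℝ) {k φ : ℝ → ℝ} (hk : Continuous k) (hφ : Continuous φ)
    (c : ℝ) : expMass a b μ k +
        c * (2 * μ * ∫ t in (0 : ℝ)..1, Real.exp (2 * μ * height a b k t) * green φ t) ≤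
      expMass a b μ fun t => k t + c * φ t := by
  have hkφ : Continuous fun t => k t + c * φ t := hk.add (continuous_const.mul hφ)
  have hc1 := continuous_exp_height a b μ hk
  have hc2 : Continuous fun t => Real.exp (2 * μ * height a b k t) * green φ t :=
    hc1.mul (continuous_green hφ)
  have hi := integral_add_mul hc1 hc2 (c * (2 * μ)) 1
  rw [← mul_assoc]
  refine hi.symm.le.trans (intervalIntegral.integral_mono_on (μ := volume) (zero_le_one (α := ℝ))
    ((hc1.add (continuous_const.mul hc2)).intervalIntegrable _ _)
    ((continuous_exp_height a b μ hkφ).intervalIntegrable _ _) fun t _ => ?_)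
  have h : 2 * μ * height a b (fun t => k t + c * φ t) t =
      2 * μ * height a b k t + c * (2 * μ) * green φ t := by
    rw [height, height, green_add_mul hk hφ]
    ring
  rw [h, Real.exp_add]
  -- The tangent line bound `1 + z ≤ e^z` makes the mass lie above its linearisation in `c`.
  have := mul_le_mul_of_nonneg_left (Real.add_one_le_exp (c * (2 * μ) * green φ t))
    (Real.exp_pos (2 * μ * height a b k t)).le
  linarith

theorem integral_greenDeriv_add_mul_sq {k φ : ℝ → ℝ} (hk : Continuous k) (hφ : Continuous φ)
    (c : ℝ) : ∫ t in (0 : ℝ)..1, greenDeriv (fun s => k s + c * φ s) t ^ 2 =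
      (∫ t in (0 : ℝ)..1, greenDeriv k t ^ 2) +
        c * (2 * ∫ t in (0 : ℝ)..1, greenDeriv k t * greenDeriv φ t) +
        c ^ 2 * ∫ t in (0 : ℝ)..1, greenDeriv φ t ^ 2 := by
  have h1 := continuous_greenDeriv hk
  have h2 := continuous_greenDeriv hφ
  have h3 := integral_add_mul (h1.pow 2) (h1.mul h2) (c * 2) 1
  have h4 := integral_add_mul ((h1.pow 2).add (continuous_const.mul (h1.mul h2)))
    (h2.pow 2) (c ^ 2) 1 (k := fun t => greenDeriv k t ^ 2 + c * 2 * (greenDeriv k t * greenDeriv φ t))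
  simp only [Pi.mul_apply, Pi.pow_apply] at h3 h4
  rw [h3] at h4
  rw [← mul_assoc, ← h4]
  refine intervalIntegral.integral_congr fun t _ => ?_
  simp only [greenDeriv_add_mul hk hφ]
  ring

/-- The first variation of `heightEnergy` at `k` in the direction `φ`. -/
theorem integral_greenDeriv_sub_nonneg {lam : Fin d → ℝ} (Δ : Fin d → ℝ)
    (a b : ℝ) {k φ : ℝ → ℝ} (hk : Continuous k) (hφ : Continuous φ)
    (hmin : ∀ c ∈ Set.Icc (0 : ℝ) 1,
      heightEnergy lam Δ a b k ≤ heightEnergy lam Δ a b fun t => k t + c * φ t) :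
    0 ≤ (∫ t in (0 : ℝ)..1, greenDeriv k t * greenDeriv φ t) -
      ∫ t in (0 : ℝ)..1, greenDeriv (geodesicSource lam Δ a b k) t * greenDeriv φ t := by
  set m : Fin d → ℝ := fun i => expMass a b (lam i) k with hm
  set β : Fin d → ℝ := fun i =>
    2 * lam i * ∫ t in (0 : ℝ)..1, Real.exp (2 * lam i * height a b k t) * green φ t with hβ
  have hmpos : ∀ i, 0 < m i := fun i => expMass_pos a b (lam i) hk
  -- Replacing the masses by their linearisations gives, for small `c > 0`, a majorant of the energy
  -- that agrees with it at `c = 0`. Thus `U` inherits the minimum from the right, and no mass has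
  -- to be differentiated under the integral sign.
  set U : ℝ → ℝ := fun c => (∫ t in (0 : ℝ)..1, greenDeriv k t ^ 2) +
    c * (2 * ∫ t in (0 : ℝ)..1, greenDeriv k t * greenDeriv φ t) +
    c ^ 2 * (∫ t in (0 : ℝ)..1, greenDeriv φ t ^ 2) + ∑ i, Δ i ^ 2 / (m i + c * β i) with hU
  have hU0 : U 0 = heightEnergy lam Δ a b k := by simp [hU, heightEnergy, hm]
  have hUle : ∀ᶠ c in 𝓝[>] (0 : ℝ), U 0 ≤ U c := by
    have hpos : ∀ᶠ c in 𝓝[>] (0 : ℝ), ∀ i, 0 < m i + c * β i := by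
      refine eventually_all.2 fun i => nhdsWithin_le_nhds ?_
      have hc : ContinuousAt (fun c : ℝ => m i + c * β i) 0 := by fun_prop
      exact hc.eventually (lt_mem_nhds (by simpa using hmpos i))
    filter_upwards [hpos, Ioo_mem_nhdsGT (zero_lt_one (α := ℝ))] with c hcpos hc
    rw [hU0]
    refine (hmin c ⟨hc.1.le, hc.2.le⟩).trans ?_
    rw [heightEnergy, integral_greenDeriv_add_mul_sq hk hφ]
    refine add_le_add_right (Finset.sum_le_sum fun i _ => ?_) _
    exact div_le_div_of_nonneg_left (sq_nonneg _) (hcpos i) (expMass_add_mul_le a b _ hk hφ c)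
  have hUd : HasDerivAt U (2 * (∫ t in (0 : ℝ)..1, greenDeriv k t * greenDeriv φ t) -
      ∑ i, Δ i ^ 2 * β i / m i ^ 2) 0 := by
    have hs : HasDerivAt (fun c : ℝ => ∑ i, Δ i ^ 2 / (m i + c * β i))
        (∑ i, -(Δ i ^ 2 * β i / m i ^ 2)) 0 := by
      refine HasDerivAt.fun_sum fun i _ => ?_
      have h1 : HasDerivAt (fun c : ℝ => m i + c * β i) (1 * β i) 0 :=
        ((hasDerivAt_id (0 : ℝ)).mul_const (β i)).const_add (m i)
      have h := (hasDerivAt_const (0 : ℝ) (Δ i ^ 2)).div h1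
        (by simpa using (hmpos i).ne')
      refine h.congr_deriv ?_
      simp
      ring
    have h := ((((hasDerivAt_id (0 : ℝ)).mul_const
      (2 * ∫ t in (0 : ℝ)..1, greenDeriv k t * greenDeriv φ t)).const_add
      (∫ t in (0 : ℝ)..1, greenDeriv k t ^ 2)).add (((hasDerivAt_id (0 : ℝ)).pow 2).mul_const
      (∫ t in (0 : ℝ)..1, greenDeriv φ t ^ 2))).add hs
    refine h.congr_deriv ?_
    simp [sub_eq_add_neg]
  have hnn := hUd.nonneg_of_eventually_le hUle
  rw [← integral_mul_green (continuous_geodesicSource lam Δ a b hk) hφ,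
    integral_geodesicSource_mul lam Δ a b hk (continuous_green hφ)]
  have hsum : ∑ i, Δ i ^ 2 * β i / m i ^ 2 = 2 * ∑ i, lam i * Δ i ^ 2 / expMass a b (lam i) k ^ 2 *
      ∫ t in (0 : ℝ)..1, Real.exp (2 * lam i * height a b k t) * green φ t := by
    rw [Finset.mul_sum]
    refine Finset.sum_congr rfl fun i _ => ?_
    simp only [hβ, hm]
    ring
  linarith

theorem exists_eq_geodesicSource {lam : Fin d → ℝ} (hlam : ∀ i, 0 < lam i) (Δ : Fin d → ℝ)
    (a b : ℝ) : ∃ k, Continuous k ∧ ∀ t ∈ Set.Ioo (0 : ℝ) 1, k t = geodesicSource lam Δ a b k t := by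
  obtain ⟨M, N, B, hM, hN, hB, hS⟩ := exists_isAdmissibleDensity_geodesicSource hlam Δ a b
  obtain ⟨k, hk, hka, hmin⟩ := exists_isAdmissibleDensity_forall_le hM hN hB
    (J := heightEnergy lam Δ a b) (fun _ _ h => heightEnergy_congr lam Δ a b h)
    (continuous_heightEnergy lam Δ a b continuous_uncurry_IccExtend
      fun x => x.continuous.Icc_extend')
  refine ⟨k, hk, ?_⟩
  set S := geodesicSource lam Δ a b k with hSdef
  have hSc : Continuous S := continuous_geodesicSource lam Δ a b hk
  set φ : ℝ → ℝ := fun t => S t - k t with hφdef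
  have hφ : Continuous φ := hSc.sub hk
  have hvar := integral_greenDeriv_sub_nonneg Δ a b hk hφ fun c hc =>
    hmin _ (hk.add (continuous_const.mul hφ)) (hka.add_mul_sub (hS k hk hka) hk hSc hc)
  have hSφ : ∀ t, greenDeriv S t = greenDeriv k t + 1 * greenDeriv φ t := fun t => by
    rw [← greenDeriv_add_mul hk hφ]
    congr 1
    funext s
    simp [hφdef]
  have hk' := continuous_greenDeriv hk
  have hφ' := continuous_greenDeriv hφ
  have hsq : ∫ t in (0 : ℝ)..1, greenDeriv S t * greenDeriv φ t =
      (∫ t in (0 : ℝ)..1, greenDeriv k t * greenDeriv φ t) +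
        1 * ∫ t in (0 : ℝ)..1, greenDeriv φ t ^ 2 := by
    refine Eq.trans ?_ (integral_add_mul (hk'.mul hφ') (hφ'.pow 2) 1 1)
    refine intervalIntegral.integral_congr fun t _ => ?_
    simp only [hSφ, Pi.mul_apply, Pi.pow_apply]
    ring
  -- By `hsq`, the quantity that `hvar` says is nonnegative equals `-∫ (greenDeriv φ)^2`.
  have hz := eq_zero_of_integral_greenDeriv_sq_nonpos hφ (by linarith)
  intro t ht
  have := hz t ht
  simp only [hφdef] at this
  linarith

theorem contDiff_two_of_hasDerivAt {f f' f'' : ℝ → ℝ} (h : ∀ t, HasDerivAt f (f' t) t)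
    (h' : ∀ t, HasDerivAt f' (f'' t) t) (hc : Continuous f'') : ContDiff ℝ 2 f := by
  have e : deriv f = f' := funext fun t => (h t).deriv
  have e' : deriv f' = f'' := funext fun t => (h' t).deriv
  have h1 : ContDiff ℝ 1 f' := by
    rw [contDiff_one_iff_deriv, e']
    exact ⟨fun t => (h' t).differentiableAt, hc⟩
  rw [show (2 : WithTop ℕ∞) = 1 + 1 by norm_num, contDiff_succ_iff_deriv, e]
  exact ⟨fun t => (h t).differentiableAt, by simp, h1⟩

/-! ### The geodesic recovered from its height. -/

theorem exists_heintze_geodesic {lam : Fin d → ℝ} (hlam : ∀ i, 0 < lam i)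
    (p q : Fin (d + 1) → ℝ) : ∃ γ, (heintzeMetric lam).IsGeodesicSegment γ p q := by
  set a := p 0
  set b := q 0
  set Δ : Fin d → ℝ := fun i => q i.succ - p i.succ with hΔ
  obtain ⟨k, hk, hks⟩ := exists_eq_geodesicSource hlam Δ a b
  set y := height a b k with hy
  -- The conserved momentum `e^{-2λ_i y} x_i'`, normalised so that `x_i` travels exactly `Δ i` in
  -- unit time.
  set c : Fin d → ℝ := fun i => Δ i / expMass a b (lam i) k with hc
  set x : Fin d → ℝ → ℝ := fun i t =>
    p i.succ + c i * ∫ s in (0 : ℝ)..t, Real.exp (2 * lam i * y s) with hx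
  have hyd : ∀ t, HasDerivAt y (b - a + greenDeriv k t) t := hasDerivAt_height a b hk
  have hyd' : ∀ t, HasDerivAt (fun t => b - a + greenDeriv k t) (-k t) t := fun t =>
    (hasDerivAt_greenDeriv hk t).const_add _
  have hxd : ∀ i t, HasDerivAt (x i) (c i * Real.exp (2 * lam i * y t)) t := fun i t =>
    ((hasDerivAt_integral_zero (continuous_exp_height a b (lam i) hk) t).const_mul (c i)).const_add _
  have hxd' : ∀ i t, HasDerivAt (fun t => c i * Real.exp (2 * lam i * y t))
      (c i * (Real.exp (2 * lam i * y t) * (2 * lam i * (b - a + greenDeriv k t)))) t :=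
    fun i t => (((hyd t).const_mul (2 * lam i)).exp).const_mul (c i)
  have hey : deriv y = fun t => b - a + greenDeriv k t := funext fun t => (hyd t).deriv
  have hex : ∀ i, deriv (x i) = fun t => c i * Real.exp (2 * lam i * y t) := fun i =>
    funext fun t => (hxd i t).deriv
  refine ⟨fun t => Fin.cons (y t) fun i => x i t, ?_, ?_, ?_, ?_⟩
  · refine ContDiff.contDiffOn (contDiff_pi.2 fun j => ?_)
    refine Fin.cases ?_ (fun i => ?_) j
    · exact contDiff_two_of_hasDerivAt hyd hyd' hk.neg
    · exact contDiff_two_of_hasDerivAt (hxd i) (hxd' i) (continuous_const.mul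
        ((continuous_exp_height a b (lam i) hk).mul (continuous_const.mul
          (continuous_const.add (continuous_greenDeriv hk)))))
  · funext j
    refine Fin.cases ?_ (fun i => ?_) j
    · simp [hy, height, a]
    · simp [hx]
  · funext j
    refine Fin.cases ?_ (fun i => ?_) j
    · simp [hy, height, b]
    · have := (expMass_pos a b (lam i) hk).ne'
      change p i.succ + Δ i / expMass a b (lam i) k * expMass a b (lam i) k = q i.succ
      rw [div_mul_cancel₀ _ this]
      simp [hΔ]
  · intro t ht j
    refine Fin.cases ?_ (fun i => ?_) j
    · rw [heintzeMetric_acceleration_zero]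
      simp only [Fin.cons_zero, Fin.cons_succ]
      change deriv (deriv y) t + ∑ i, lam i * Real.exp (-2 * lam i * y t) * deriv (x i) t ^ 2 = 0
      rw [hey, (hyd' t).deriv, hks t ht, geodesicSource, neg_add_eq_zero]
      refine Finset.sum_congr rfl fun i _ => ?_
      have he : Real.exp (-2 * lam i * y t) * Real.exp (2 * lam i * y t) = 1 := by
        rw [← Real.exp_add]
        simp
      rw [hex]
      simp only [hc]
      linear_combination (-lam i * (Δ i / expMass a b (lam i) k) ^ 2 *
        Real.exp (2 * lam i * y t)) * he
    · rw [heintzeMetric_acceleration_succ]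
      simp only [Fin.cons_zero, Fin.cons_succ]
      change deriv (deriv (x i)) t - 2 * lam i * deriv y t * deriv (x i) t = 0
      rw [hex, (hxd' i t).deriv, hey]
      ring

end HeintzeExistence

theorem mainTheorem9 (d : ℕ) (lam : Fin d → ℝ) (hlam : ∀ i, 0 < lam i) :
    (heintzeMetric lam).IsGeodesicallyConvex (heintzeV lam) :=
  fun p hp q hq => ⟨exists_heintze_geodesic hlam p q,
    fun _ hγ _ ht => heintze_geodesic_mem hlam hp hq hγ ht⟩
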